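/- Let $0\le t_0\le T$, let $b:[t_0,T]\to\mathbb R$ be twice differentiable, and let $V\ge 0$. Then there is a constant $C\ge 0$, depending only on $b,t_0,T,V$, with the following property. Let $W$ be a Wiener process with respect to a filtration on a probability space, and let $X$ solve the Itô equation $dX=b(t)\,dW$ on $[t_0,T]$, that is, $X(t)=X(t_0)+\int_{t_0}^t b(u)\,dW(u)$ for $t_0\le t\le T$, with arbitrary initial value $X(t_0)$. Let $S_0,S_1,\dots$ be independent random variables with $\operatorname{E}[S_k]=0$ and $\operatorname{Var}[S_k]\le V$, the whole sequence being independent of $W$ (for example independent random signs $S_k=\pm1$, each with probability $1/2$). Let $h>0$ and let $m\ge 0$ be an integer with $t_0+mh\le T$; put $t_k=t_0+kh$ and $\Delta W_k=W(t_{k+1})-W(t_k)$. For an equation $dX=a(t,X)\,dt+b(t,X)\,dW$, one step of the Runge--Kutta like scheme takes a value $x$ at time $t_k$ to $\Phi_k(x)=x+\tfrac12(K_1+K_2)$, where $$K_1=h\,a(t_k,x)+(\Delta W_k-S_k\sqrt h)\,b(t_k,x),\qquad K_2=h\,a(t_{k+1},x+K_1)+(\Delta W_k+S_k\sqrt h)\,b(t_{k+1},x+K_1);$$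 here it is applied with $a=0$ and $b(t,x)=b(t)$. Let $\hat X_0=X(t_0)$ and $\hat X_{k+1}=\Phi_k(\hat X_k)$. Define the local errors $\epsilon_k=X(t_{k+1})-\Phi_k(X(t_k))$ for $0\le k<m$ and the global error $\epsilon=X(t_m)-\hat X_m$. Then: 1. each local error $\epsilon_k$, $0\le k<m$, is square integrable, with $\operatorname{E}[\epsilon_k]=0$ and $\operatorname{Var}[\epsilon_k]\le C h^3$; 2. the local errors $\epsilon_0,\dots,\epsilon_{m-1}$ are independent, and $\epsilon=\sum_{k=0}^{m-1}\epsilon_k$; 3. the global error $\epsilon$ is square integrable, with $\operatorname{E}[\epsilon]=0$ and $\operatorname{Var}[\epsilon]\le C h^2$, and it is of size $O(h)$ in mean square: $\operatorname{E}[\epsilon^2]^{1/2}\le C h$. -/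

import Mathlib

open MeasureTheory ProbabilityTheory Filter Topology
open scoped NNReal ENNReal

/-- `W` is a Wiener process relative to the filtration `F`: it has the law of a Wiener process
(`W 0 = 0`, independent increments, `W t - W s` normal with mean zero and variance `t - s`), it is
adapted to `F`, and each increment `W t - W s` is independent of `F s`. Continuity of the sample
paths is not demanded, so every Wiener process in the usual sense qualifies. -/
structure IsWienerProcess {Ω : Type*} {mΩ : MeasurableSpace Ω} (F : Filtration ℝ≥0 mΩ)
    (W : ℝ≥0 → Ω → ℝ) (P : Measure Ω) : Prop where
  law : IsPreBrownianReal W P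
  adapted : StronglyAdapted F W
  indep : ∀ s t : ℝ≥0, s ≤ t →
    Indep (MeasurableSpace.comap (fun ω => W t ω - W s ω) inferInstance) (F s) P

/-- A simple (elementary) nonanticipating process on `[s, t]`: given a partition
`s = time 0 ≤ time 1 ≤ ... ≤ time n = t`, the process takes on `(time i, time (i + 1)]` the bounded
random value `val i`, which is known at the left end point `time i`. -/
structure ItoSimpleProcess {Ω : Type*} {mΩ : MeasurableSpace Ω} (F : Filtration ℝ≥0 mΩ)
    (s t : ℝ≥0) where
  n : ℕ
  time : ℕ → ℝ≥0
  time_mono : Monotone time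
  time_first : time 0 = s
  time_last : time n = t
  val : ℕ → Ω → ℝ
  val_meas : ∀ i, StronglyMeasurable[F (time i)] (val i)
  val_bdd : ∃ c : ℝ, ∀ i ω, |val i ω| ≤ c

namespace ItoSimpleProcess

variable {Ω : Type*} {mΩ : MeasurableSpace Ω} {F : Filtration ℝ≥0 mΩ} {s t : ℝ≥0}

/-- The value at time `u` of a simple process. -/
noncomputable def eval (φ : ItoSimpleProcess F s t) (u : ℝ) (ω : Ω) : ℝ :=
  ∑ i ∈ Finset.range φ.n,
    Set.indicator (Set.Ioc (φ.time i : ℝ) (φ.time (i + 1) : ℝ)) (fun _ => φ.val i ω) u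

/-- The stochastic integral `∫ φ dW` of a simple process over `[s, t]`. -/
noncomputable def integral (φ : ItoSimpleProcess F s t) (W : ℝ≥0 → Ω → ℝ) (ω : Ω) : ℝ :=
  ∑ i ∈ Finset.range φ.n, φ.val i ω * (W (φ.time (i + 1)) ω - W (φ.time i) ω)

end ItoSimpleProcess

/-- `I` is (a version of) the Itô integral `∫ f(u, ω) dW` over `s ≤ u ≤ t`, for integrands `f` that
are square integrable for `du ⊗ P`: there are simple processes that converge to `f` in
`L²(du ⊗ P)` and whose stochastic integrals converge to `I` in `L²(P)`. -/
def IsItoIntegral {Ω : Type*} {mΩ : MeasurableSpace Ω} (F : Filtration ℝ≥0 mΩ)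
    (W : ℝ≥0 → Ω → ℝ) (P : Measure Ω) (f : ℝ → Ω → ℝ) (s t : ℝ≥0) (I : Ω → ℝ) : Prop :=
  MemLp I 2 P ∧ ∃ φ : ℕ → ItoSimpleProcess F s t,
    Tendsto (fun n => ∫⁻ u in Set.Ioc (s : ℝ) (t : ℝ),
      ∫⁻ ω, ‖(φ n).eval u ω - f u ω‖ₑ ^ 2 ∂P) atTop (𝓝 0) ∧
    Tendsto (fun n => eLpNorm (fun ω => (φ n).integral W ω - I ω) 2 P) atTop (𝓝 0)

/-- `X` solves the Itô equation `dX = b(t) dW` on `[t₀, T]`, that is,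
`X t = X t₀ + ∫_{t₀}^t b(u) dW` for `t₀ ≤ t ≤ T`. The initial value `X t₀` is arbitrary. -/
def SolvesAdditiveSDE {Ω : Type*} {mΩ : MeasurableSpace Ω} (F : Filtration ℝ≥0 mΩ)
    (W : ℝ≥0 → Ω → ℝ) (P : Measure Ω) (b : ℝ → ℝ) (t₀ T : ℝ≥0) (X : ℝ≥0 → Ω → ℝ) : Prop :=
  ∀ t : ℝ≥0, t₀ ≤ t → t ≤ T →
    IsItoIntegral F W P (fun u _ => b u) t₀ t (fun ω => X t ω - X t₀ ω)

/-- One step of the Runge--Kutta like scheme for `dX = a(t, X) dt + b(t, X) dW`, of size `h`, from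
the value `x` at time `t`, with noise increment `dW` and sign `S`. -/
noncomputable def rkStep (a b : ℝ → ℝ → ℝ) (t h x dW S : ℝ) : ℝ :=
  let K₁ := h * a t x + (dW - S * √h) * b t x
  let K₂ := h * a (t + h) (x + K₁) + (dW + S * √h) * b (t + h) (x + K₁)
  x + (1 / 2) * (K₁ + K₂)

/-- The grid times `t_k = t₀ + k h`. -/
noncomputable def gridTime (t₀ h : ℝ≥0) (k : ℕ) : ℝ≥0 := t₀ + k * h

/-- One step of the scheme along the realisation `ω`, from the value `x` at `t_k`, driven by the
increment `W(t_{k+1}) - W(t_k)` and the sign `S_k`. -/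
noncomputable def rkGridStep {Ω : Type*} (a b : ℝ → ℝ → ℝ) (W : ℝ≥0 → Ω → ℝ) (S : ℕ → Ω → ℝ)
    (t₀ h : ℝ≥0) (k : ℕ) (ω : Ω) (x : ℝ) : ℝ :=
  rkStep a b (gridTime t₀ h k) h x
    (W (gridTime t₀ h (k + 1)) ω - W (gridTime t₀ h k) ω) (S k ω)

/-- The numerical approximations `X̂_0 = x₀`, `X̂_1`, `X̂_2`, ... at the grid times. -/
noncomputable def rkScheme {Ω : Type*} (a b : ℝ → ℝ → ℝ) (W : ℝ≥0 → Ω → ℝ) (S : ℕ → Ω → ℝ)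
    (t₀ h : ℝ≥0) (x₀ : Ω → ℝ) : ℕ → Ω → ℝ
  | 0 => x₀
  | k + 1 => fun ω => rkGridStep a b W S t₀ h k ω (rkScheme a b W S t₀ h x₀ k ω)

/-- The local error of step `k`: the exact value at `t_{k+1}` minus the result of one step of the
scheme started from the exact value at `t_k`. -/
noncomputable def rkLocalError {Ω : Type*} (a b : ℝ → ℝ → ℝ) (W : ℝ≥0 → Ω → ℝ) (S : ℕ → Ω → ℝ)
    (t₀ h : ℝ≥0) (X : ℝ≥0 → Ω → ℝ) (k : ℕ) (ω : Ω) : ℝ :=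
  X (gridTime t₀ h (k + 1)) ω - rkGridStep a b W S t₀ h k ω (X (gridTime t₀ h k) ω)

/-- The global error after `m` steps: the exact value at `t_m` minus the numerical one, when the
scheme is started from the exact initial value. -/
noncomputable def rkGlobalError {Ω : Type*} (a b : ℝ → ℝ → ℝ) (W : ℝ≥0 → Ω → ℝ) (S : ℕ → Ω → ℝ)
    (t₀ h : ℝ≥0) (X : ℝ≥0 → Ω → ℝ) (m : ℕ) (ω : Ω) : ℝ :=
  X (gridTime t₀ h m) ω - rkScheme a b W S t₀ h (X t₀) m ω

/-! Since the diffusion coefficient does not depend on the state, `K₁` drops out of the second stage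
and one step is a translation: it adds `gridMean` times the Wiener increment plus `signCoeff` times
the sign. Hence the local errors do not depend on the starting value and sum exactly to the global
error (`rkGlobalError_eq_sum`). Each local error is the Itô integral of `b - gridMean` over one
step, minus `signCoeff * S k`.

Size: `b` has a bounded derivative, so it is Lipschitz with some constant `L`, and `b - gridMean` is
at most `L h` on the step. By the Itô isometry (`IsItoLimit.eLpNorm_eq`) the integral has `L²` norm
at most `L h √h`; the sign term contributes at most `√V / 2` times as much. Both parts have mean
zero, so the local variance is `O(h³)`.

Independence: on each step the integral is an `L²` limit of Riemann sums (`eLpNorm_sub_cellSum_le`).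
For different steps these sums use disjoint increments of `W`, so they are independent, and adding
the signs, independent of `W`, keeps this. By characteristic functions independence survives `L²`
limits (`iIndepFun_of_tendsto_eLpNorm`). Variances then add, and `m h ≤ T` turns `m` terms of order
`h³` into `O(h²)`. -/

/-! ### Moments of products of Wiener increments -/

section WienerMoments

variable {Ω : Type*} {mΩ : MeasurableSpace Ω} {F : Filtration ℝ≥0 mΩ} {W : ℝ≥0 → Ω → ℝ}
  {P : Measure Ω}

namespace IsWienerProcess

lemma measurable (hW : IsWienerProcess F W P) (t : ℝ≥0) : Measurable (W t) :=
  ((hW.adapted t).mono (F.le t)).measurable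

lemma memLp_sub (hW : IsWienerProcess F W P) (s t : ℝ≥0) :
    MemLp (fun ω => W t ω - W s ω) 2 P :=
  (hW.law.isGaussianProcess.hasGaussianLaw_eval t).memLp_two.sub
    (hW.law.isGaussianProcess.hasGaussianLaw_eval s).memLp_two

lemma integral_sub (hW : IsWienerProcess F W P) (s t : ℝ≥0) :
    ∫ ω, (W t ω - W s ω) ∂P = 0 := by
  rw [MeasureTheory.integral_sub (hW.law.integrable_eval t) (hW.law.integrable_eval s),
    hW.law.integral_eval, hW.law.integral_eval, sub_zero]

lemma integral_sub_sq (hW : IsWienerProcess F W P) {s t : ℝ≥0} (hst : s ≤ t) :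
    ∫ ω, (W t ω - W s ω) ^ 2 ∂P = t - s := by
  have h := (hW.law.hasLaw_sub t s).variance_eq
  rw [variance_id_gaussianReal, variance_eq_integral (by
    exact (hW.memLp_sub s t).aestronglyMeasurable.aemeasurable)] at h
  have h0 : ∫ ω, (W t - W s) ω ∂P = 0 := hW.integral_sub s t
  simp only [h0, sub_zero] at h
  refine h.trans ?_
  have : (s : ℝ) ≤ t := hst
  rw [coe_nndist, Real.dist_eq, abs_of_nonneg]
  · rfl
  · exact sub_nonneg.2 this

lemma stronglyMeasurable_sub (hW : IsWienerProcess F W P) {s t r : ℝ≥0} (hs : s ≤ r)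
    (ht : t ≤ r) : StronglyMeasurable[F r] (fun ω => W t ω - W s ω) :=
  ((hW.adapted t).mono (F.mono ht)).sub ((hW.adapted s).mono (F.mono hs))

lemma indepFun (hW : IsWienerProcess F W P) {s t : ℝ≥0} (hst : s ≤ t) {ζ : Ω → ℝ}
    (hζ : StronglyMeasurable[F s] ζ) : IndepFun ζ (fun ω => W t ω - W s ω) P := by
  rw [IndepFun_iff_Indep]
  exact (indep_of_indep_of_le_right (hW.indep s t hst) hζ.measurable.comap_le).symm

/-- The product rule for independent variables needs measurability alone, so `ζ` may be unbounded;
below it is often itself a product containing Wiener increments. -/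
lemma integral_mul_sub (hW : IsWienerProcess F W P) {s t : ℝ≥0} (hst : s ≤ t) {ζ : Ω → ℝ}
    (hζ : StronglyMeasurable[F s] ζ) : ∫ ω, ζ ω * (W t ω - W s ω) ∂P = 0 := by
  rw [(hW.indepFun hst hζ).integral_fun_mul_eq_mul_integral
    (hζ.mono (F.le s)).aestronglyMeasurable (hW.memLp_sub s t).aestronglyMeasurable,
    hW.integral_sub, mul_zero]

lemma integral_mul_sub_sq (hW : IsWienerProcess F W P) {s t : ℝ≥0} (hst : s ≤ t) {ζ : Ω → ℝ}
    (hζ : StronglyMeasurable[F s] ζ) :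
    ∫ ω, ζ ω * (W t ω - W s ω) ^ 2 ∂P = (t - s) * ∫ ω, ζ ω ∂P := by
  have h := (hW.indepFun hst hζ).comp measurable_id (measurable_id.pow_const 2)
  have h2 := h.integral_fun_mul_eq_mul_integral (hζ.mono (F.le s)).aestronglyMeasurable
    ((hW.memLp_sub s t).aestronglyMeasurable.aemeasurable.pow_const 2).aestronglyMeasurable
  simp only [Function.comp_def, id_eq] at h2
  rw [h2, hW.integral_sub_sq hst, mul_comm]

lemma memLp_mul_sub (hW : IsWienerProcess F W P) {ζ : Ω → ℝ} (hζ : Measurable ζ)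
    {K : ℝ} (hK : ∀ ω, |ζ ω| ≤ K) (s t : ℝ≥0) :
    MemLp (fun ω => ζ ω * (W t ω - W s ω)) 2 P :=
  (hW.memLp_sub s t).mul (p := ∞) (q := 2) (r := 2)
    (memLp_top_of_bound hζ.aestronglyMeasurable K (Eventually.of_forall hK))

lemma integrable_mul_sub_mul_sub (hW : IsWienerProcess F W P) {ζ : Ω → ℝ} (hζ : Measurable ζ)
    {K : ℝ} (hK : ∀ ω, |ζ ω| ≤ K) (s t u v : ℝ≥0) :
    Integrable (fun ω => ζ ω * (W t ω - W s ω) * (W v ω - W u ω)) P :=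
  (hW.memLp_mul_sub hζ hK s t).integrable_mul (hW.memLp_sub u v)

lemma integral_mul_sub_mul_sub_same (hW : IsWienerProcess F W P) {d c e : ℝ≥0} (hc : d ≤ c)
    (he : d ≤ e) {ζ : Ω → ℝ} (hζ : StronglyMeasurable[F d] ζ) {K : ℝ} (hK : ∀ ω, |ζ ω| ≤ K) :
    ∫ ω, ζ ω * (W c ω - W d ω) * (W e ω - W d ω) ∂P = (min (c : ℝ) e - d) * ∫ ω, ζ ω ∂P := by
  wlog hce : c ≤ e generalizing c e
  · rw [min_comm, ← this he hc (le_of_not_ge hce)]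
    exact integral_congr_ae (Eventually.of_forall fun ω => by ring)
  have hm := (hζ.mono (F.le d)).measurable
  have h : ∀ ω, ζ ω * (W c ω - W d ω) * (W e ω - W d ω) =
      ζ ω * (W c ω - W d ω) * (W c ω - W d ω) + ζ ω * (W c ω - W d ω) * (W e ω - W c ω) :=
    fun ω => by ring
  simp_rw [h]
  rw [integral_add (hW.integrable_mul_sub_mul_sub hm hK _ _ _ _)
    (hW.integrable_mul_sub_mul_sub hm hK _ _ _ _),
    hW.integral_mul_sub hce (ζ := fun ω => ζ ω * (W c ω - W d ω)) ((hζ.mono (F.mono hc)).mul (hW.stronglyMeasurable_sub hc le_rfl)),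
    add_zero, min_eq_left (by exact_mod_cast hce), ← hW.integral_mul_sub_sq hc hζ]
  exact integral_congr_ae (Eventually.of_forall fun ω => by ring)

/-- The Itô isometry, polarised, for elementary integrands: the factor is the length of the overlap
of the two intervals. With `a ≤ d`, cut `W c - W a` at `d`; whatever is known by time `d` is
orthogonal to the later increment. -/
lemma integral_mul_mul (hW : IsWienerProcess F W P) {a c d e : ℝ≥0} (hac : a ≤ c) (hde : d ≤ e)
    {ξ η : Ω → ℝ} (hξ : StronglyMeasurable[F a] ξ) (hη : StronglyMeasurable[F d] η)
    {K K' : ℝ} (hK : ∀ ω, |ξ ω| ≤ K) (hK' : ∀ ω, |η ω| ≤ K') :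
    ∫ ω, (ξ ω * (W c ω - W a ω)) * (η ω * (W e ω - W d ω)) ∂P =
      max (min (c : ℝ) e - max (a : ℝ) d) 0 * ∫ ω, ξ ω * η ω ∂P := by
  wlog had : a ≤ d generalizing a c d e ξ η K K'
  · have := this hde hac hη hξ hK' hK (le_of_not_ge had)
    simp only [min_comm (c : ℝ), max_comm (a : ℝ), mul_comm (ξ _)]
    rw [← this]
    exact integral_congr_ae (Eventually.of_forall fun ω => by ring)
  have hξ' := hξ.mono (F.mono had)
  have had' : (a : ℝ) ≤ d := had
  have hde' : (d : ℝ) ≤ e := hde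
  rcases le_total c d with hcd | hdc
  · have hcd' : (c : ℝ) ≤ d := hcd
    have h := hW.integral_mul_sub hde
      ((hξ'.mul (hW.stronglyMeasurable_sub had hcd)).mul hη)
    rw [max_eq_right, zero_mul, ← h]
    · exact integral_congr_ae (Eventually.of_forall fun ω => by simp only [Pi.mul_apply]; ring)
    · rw [max_eq_right had']
      linarith [min_le_left (c : ℝ) e]
  · have hdc' : (d : ℝ) ≤ c := hdc
    have hζ : StronglyMeasurable[F d] (fun ω => ξ ω * η ω) := hξ'.mul hη
    have hζK : ∀ ω, |ξ ω * η ω| ≤ K * K' := fun ω => by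
      rw [abs_mul]
      exact mul_le_mul (hK ω) (hK' ω) (abs_nonneg _) ((abs_nonneg _).trans (hK ω))
    have hm := (hζ.mono (F.le d)).measurable
    have h : ∀ ω, (ξ ω * (W c ω - W a ω)) * (η ω * (W e ω - W d ω)) =
        ξ ω * η ω * (W d ω - W a ω) * (W e ω - W d ω) +
        ξ ω * η ω * (W c ω - W d ω) * (W e ω - W d ω) := fun ω => by ring
    simp_rw [h]
    rw [integral_add (hW.integrable_mul_sub_mul_sub hm hζK _ _ _ _)
      (hW.integrable_mul_sub_mul_sub hm hζK _ _ _ _),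
      hW.integral_mul_sub hde (ζ := fun ω => ξ ω * η ω * (W d ω - W a ω))
        (hζ.mul (hW.stronglyMeasurable_sub had le_rfl)), zero_add,
      hW.integral_mul_sub_mul_sub_same hdc hde hζ hζK, max_eq_right had', max_eq_left]
    exact sub_nonneg.2 (le_min hdc' hde')

end IsWienerProcess

end WienerMoments

/-! ### Itô isometry by density of simple integrands -/

section ItoIsometry

variable {Ω : Type*} {mΩ : MeasurableSpace Ω} {F : Filtration ℝ≥0 mΩ} {W : ℝ≥0 → Ω → ℝ}
  {P : Measure Ω}

/-- The pairs `(ξ 1_{(a, c]}, ξ (W c - W a))` of an elementary integrand and its integral. -/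
def itoGenerators (F : Filtration ℝ≥0 mΩ) (W : ℝ≥0 → Ω → ℝ) : Set ((ℝ × Ω → ℝ) × (Ω → ℝ)) :=
  {p | ∃ (a c : ℝ≥0) (ξ : Ω → ℝ) (K : ℝ), a ≤ c ∧ StronglyMeasurable[F a] ξ ∧
    (∀ ω, |ξ ω| ≤ K) ∧
    p = (fun q => (Set.Ioc (a : ℝ) c).indicator (fun _ => ξ q.2) q.1,
      fun ω => ξ ω * (W c ω - W a ω))}

/-- The pairs of a simple integrand, on no fixed partition, and its stochastic integral. -/
def itoElementary (F : Filtration ℝ≥0 mΩ) (W : ℝ≥0 → Ω → ℝ) :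
    Submodule ℝ ((ℝ × Ω → ℝ) × (Ω → ℝ)) :=
  Submodule.span ℝ (itoGenerators F W)

lemma memLp_fst_of_mem_itoElementary [IsFiniteMeasure P] {p : (ℝ × Ω → ℝ) × (Ω → ℝ)}
    (hp : p ∈ itoElementary F W) : MemLp p.1 2 (volume.prod P) := by
  induction hp using Submodule.span_induction with
  | mem p hp =>
    obtain ⟨a, c, ξ, K, -, hξ, hK, rfl⟩ := hp
    have h1 : MemLp ((Set.Ioc (a : ℝ) c).indicator (fun _ => (1 : ℝ))) 2 volume :=
      memLp_indicator_const 2 measurableSet_Ioc 1 (Or.inr measure_Ioc_lt_top.ne)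
    have h2 : MemLp (fun q : ℝ × Ω => ξ q.2) ∞ ((volume : Measure ℝ).prod P) :=
      memLp_top_of_bound ((hξ.mono (F.le a)).comp_measurable measurable_snd).aestronglyMeasurable K
        (Eventually.of_forall fun q => hK q.2)
    refine (h2.mul (p := 2) (q := ∞) (r := 2) (h1.comp_fst P)).ae_eq
      (Eventually.of_forall fun q => ?_)
    by_cases hq : q.1 ∈ Set.Ioc (a : ℝ) c <;> simp [hq]
  | zero => exact MemLp.zero
  | add p q _ _ hp hq => exact hp.add hq
  | smul r p _ hp => exact hp.const_smul r

lemma memLp_snd_of_mem_itoElementary (hW : IsWienerProcess F W P) {p : (ℝ × Ω → ℝ) × (Ω → ℝ)}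
    (hp : p ∈ itoElementary F W) : MemLp p.2 2 P := by
  induction hp using Submodule.span_induction with
  | mem p hp =>
    obtain ⟨a, c, ξ, K, -, hξ, hK, rfl⟩ := hp
    exact hW.memLp_mul_sub (hξ.mono (F.le a)).measurable hK a c
  | zero => exact MemLp.zero
  | add p q _ _ hp hq => exact hp.add hq
  | smul r p _ hp => exact hp.const_smul r

lemma integral_snd_of_mem_itoElementary [IsFiniteMeasure P] (hW : IsWienerProcess F W P)
    {p : (ℝ × Ω → ℝ) × (Ω → ℝ)} (hp : p ∈ itoElementary F W) : ∫ ω, p.2 ω ∂P = 0 := by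
  induction hp using Submodule.span_induction with
  | mem p hp =>
    obtain ⟨a, c, ξ, K, hac, hξ, hK, rfl⟩ := hp
    exact hW.integral_mul_sub hac hξ
  | zero => simp
  | add p q hp' hq' hp hq =>
    simp only [Prod.snd_add, Pi.add_apply]
    rw [integral_add ((memLp_snd_of_mem_itoElementary hW hp').integrable one_le_two)
      ((memLp_snd_of_mem_itoElementary hW hq').integrable one_le_two), hp, hq, add_zero]
  | smul r p _ hp =>
    simp only [Prod.smul_snd, Pi.smul_apply]
    rw [integral_smul, hp, smul_zero]

/-- Both sides are bilinear in the pairs, so `integral_mul_mul` on generators suffices. Keeping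
integrand and integral together as a pair avoids common refinements of partitions and any question
of well-definedness. -/
lemma integral_mul_of_mem_itoElementary [IsFiniteMeasure P] (hW : IsWienerProcess F W P)
    {p q : (ℝ × Ω → ℝ) × (Ω → ℝ)} (hp : p ∈ itoElementary F W) (hq : q ∈ itoElementary F W) :
    ∫ ω, p.2 ω * q.2 ω ∂P = ∫ z, p.1 z * q.1 z ∂(volume.prod P) := by
  have i1 {x y : (ℝ × Ω → ℝ) × (Ω → ℝ)} (hx : x ∈ itoElementary F W)
      (hy : y ∈ itoElementary F W) : Integrable (fun z => x.1 z * y.1 z) (volume.prod P) :=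
    (memLp_fst_of_mem_itoElementary hx).integrable_mul (memLp_fst_of_mem_itoElementary hy)
  have i2 {x y : (ℝ × Ω → ℝ) × (Ω → ℝ)} (hx : x ∈ itoElementary F W)
      (hy : y ∈ itoElementary F W) : Integrable (fun ω => x.2 ω * y.2 ω) P :=
    (memLp_snd_of_mem_itoElementary hW hx).integrable_mul (memLp_snd_of_mem_itoElementary hW hy)
  induction hp, hq using Submodule.span_induction₂ with
  | mem_mem x y hx hy =>
    obtain ⟨a, c, ξ, K, hac, hξ, hK, rfl⟩ := hx
    obtain ⟨d, e, η, K', hde, hη, hK', rfl⟩ := hy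
    have h : ∀ z : ℝ × Ω, (Set.Ioc (a : ℝ) c).indicator (fun _ => ξ z.2) z.1 *
        (Set.Ioc (d : ℝ) e).indicator (fun _ => η z.2) z.1 =
        (Set.Ioc (max (a : ℝ) d) (min (c : ℝ) e)).indicator (fun _ => (1 : ℝ)) z.1 *
          (ξ z.2 * η z.2) := fun z => by
      rw [← Set.Ioc_inter_Ioc, ← Set.indicator_indicator]
      by_cases h1 : z.1 ∈ Set.Ioc (a : ℝ) c <;> by_cases h2 : z.1 ∈ Set.Ioc (d : ℝ) e <;>
        simp [h1, h2]
    simp only [h]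
    rw [integral_prod_mul ((Set.Ioc (max (a : ℝ) d) (min (c : ℝ) e)).indicator
        (fun _ => (1 : ℝ))) (fun ω => ξ ω * η ω), hW.integral_mul_mul hac hde hξ hη hK hK',
      integral_indicator measurableSet_Ioc]
    simp [Real.volume_real_Ioc]
  | zero_left y hy => simp
  | zero_right x hx => simp
  | add_left x y z hx hy hz h1 h2 =>
    simp only [Prod.snd_add, Prod.fst_add, Pi.add_apply, add_mul]
    rw [integral_add (i2 hx hz) (i2 hy hz), integral_add (i1 hx hz) (i1 hy hz), h1, h2]
  | add_right x y z hx hy hz h1 h2 =>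
    simp only [Prod.snd_add, Prod.fst_add, Pi.add_apply, mul_add]
    rw [integral_add (i2 hx hy) (i2 hx hz), integral_add (i1 hx hy) (i1 hx hz), h1, h2]
  | smul_left r x y hx hy h =>
    simp only [Prod.smul_snd, Prod.smul_fst, Pi.smul_apply, smul_eq_mul, mul_assoc]
    rw [integral_const_mul, integral_const_mul, h]
  | smul_right r x y hx hy h =>
    simp only [Prod.smul_snd, Prod.smul_fst, Pi.smul_apply, smul_eq_mul, mul_left_comm _ r]
    rw [integral_const_mul, integral_const_mul, h]

lemma eLpNorm_two_eq_ofReal_sqrt {α : Type*} {mα : MeasurableSpace α} {μ : Measure α}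
    {f : α → ℝ} (hf : MemLp f 2 μ) :
    eLpNorm f 2 μ = ENNReal.ofReal (√(∫ x, f x ^ 2 ∂μ)) := by
  rw [hf.eLpNorm_eq_integral_rpow_norm two_ne_zero ENNReal.ofNat_ne_top, Real.sqrt_eq_rpow]
  simp

lemma eLpNorm_eq_of_mem_itoElementary [IsFiniteMeasure P] (hW : IsWienerProcess F W P)
    {p : (ℝ × Ω → ℝ) × (Ω → ℝ)} (hp : p ∈ itoElementary F W) :
    eLpNorm p.2 2 P = eLpNorm p.1 2 (volume.prod P) := by
  rw [eLpNorm_two_eq_ofReal_sqrt (memLp_snd_of_mem_itoElementary hW hp),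
    eLpNorm_two_eq_ofReal_sqrt (memLp_fst_of_mem_itoElementary hp)]
  simp only [pow_two, integral_mul_of_mem_itoElementary hW hp hp]

/-- `I` is a version of the stochastic integral over `(0, ∞)` of the integrand `f`: the pair
`(f, I)` is an `L²` limit of pairs of simple integrands and their integrals. -/
structure IsItoLimit (F : Filtration ℝ≥0 mΩ) (W : ℝ≥0 → Ω → ℝ) (P : Measure Ω)
    (f : ℝ × Ω → ℝ) (I : Ω → ℝ) : Prop where
  memLp_integrand : MemLp f 2 (volume.prod P)
  memLp : MemLp I 2 P
  exists_seq : ∃ p : ℕ → (ℝ × Ω → ℝ) × (Ω → ℝ), (∀ n, p n ∈ itoElementary F W) ∧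
    Tendsto (fun n => eLpNorm ((p n).1 - f) 2 (volume.prod P)) atTop (𝓝 0) ∧
    Tendsto (fun n => eLpNorm ((p n).2 - I) 2 P) atTop (𝓝 0)

/-- Triangle inequality in both spaces. Used once in each direction, it carries the isometry to
limits. -/
lemma le_of_tendsto_eLpNorm_sub {α β : Type*} {mα : MeasurableSpace α} {mβ : MeasurableSpace β}
    {μ : Measure α} {ν : Measure β} {f : ℕ → α → ℝ} {f' : α → ℝ} {g : ℕ → β → ℝ} {g' : β → ℝ}
    (hf : ∀ n, MemLp (f n) 2 μ) (hf' : MemLp f' 2 μ) (hg : ∀ n, MemLp (g n) 2 ν)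
    (hg' : MemLp g' 2 ν) (h : ∀ n, eLpNorm (f n) 2 μ = eLpNorm (g n) 2 ν)
    (hff : Tendsto (fun n => eLpNorm (f n - f') 2 μ) atTop (𝓝 0))
    (hgg : Tendsto (fun n => eLpNorm (g n - g') 2 ν) atTop (𝓝 0)) :
    eLpNorm f' 2 μ ≤ eLpNorm g' 2 ν := by
  have hlim := (hff.add hgg).add_const (eLpNorm g' 2 ν)
  rw [add_zero, zero_add] at hlim
  refine ge_of_tendsto hlim (Eventually.of_forall fun n => ?_)
  calc eLpNorm f' 2 μ = eLpNorm (f n - (f n - f')) 2 μ := by rw [sub_sub_cancel]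
    _ ≤ eLpNorm (f n) 2 μ + eLpNorm (f n - f') 2 μ :=
      eLpNorm_sub_le (hf n).1 ((hf n).sub hf').1 one_le_two
    _ = eLpNorm ((g n - g') + g') 2 ν + eLpNorm (f n - f') 2 μ := by rw [h, sub_add_cancel]
    _ ≤ eLpNorm (g n - g') 2 ν + eLpNorm g' 2 ν + eLpNorm (f n - f') 2 μ := by
      gcongr
      exact eLpNorm_add_le ((hg n).sub hg').1 hg'.1 one_le_two
    _ = _ := by rw [add_comm, add_assoc]

lemma tendsto_eLpNorm_sub_sub {α : Type*} {mα : MeasurableSpace α}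
    {μ : Measure α} {f g : ℕ → α → ℝ} {f' g' : α → ℝ}
    (hf : ∀ n, MemLp (f n) 2 μ) (hf' : MemLp f' 2 μ) (hg : ∀ n, MemLp (g n) 2 μ)
    (hg' : MemLp g' 2 μ) (hff : Tendsto (fun n => eLpNorm (f n - f') 2 μ) atTop (𝓝 0))
    (hgg : Tendsto (fun n => eLpNorm (g n - g') 2 μ) atTop (𝓝 0)) :
    Tendsto (fun n => eLpNorm ((f n - g n) - (f' - g')) 2 μ) atTop (𝓝 0) := by
  have hlim := hff.add hgg
  rw [add_zero] at hlim
  refine tendsto_of_tendsto_of_tendsto_of_le_of_le tendsto_const_nhds hlim (fun _ => zero_le)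
    fun n => ?_
  rw [sub_sub_sub_comm]
  exact eLpNorm_sub_le ((hf n).sub hf').1 ((hg n).sub hg').1 one_le_two

namespace IsItoLimit

variable {f g : ℝ × Ω → ℝ} {I J : Ω → ℝ}

lemma eLpNorm_eq [IsFiniteMeasure P] (hW : IsWienerProcess F W P) (hf : IsItoLimit F W P f I) :
    eLpNorm I 2 P = eLpNorm f 2 (volume.prod P) := by
  obtain ⟨p, hp, h1, h2⟩ := hf.exists_seq
  exact le_antisymm
    (le_of_tendsto_eLpNorm_sub (fun n => memLp_snd_of_mem_itoElementary hW (hp n)) hf.memLp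
      (fun n => memLp_fst_of_mem_itoElementary (hp n)) hf.memLp_integrand
      (fun n => eLpNorm_eq_of_mem_itoElementary hW (hp n)) h2 h1)
    (le_of_tendsto_eLpNorm_sub (fun n => memLp_fst_of_mem_itoElementary (hp n))
      hf.memLp_integrand (fun n => memLp_snd_of_mem_itoElementary hW (hp n)) hf.memLp
      (fun n => (eLpNorm_eq_of_mem_itoElementary hW (hp n)).symm) h1 h2)

/-- On a probability space `L²` convergence implies `L¹` convergence, so the zero means of the
approximants persist. -/
lemma integral_eq_zero [IsProbabilityMeasure P] (hW : IsWienerProcess F W P)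
    (hf : IsItoLimit F W P f I) : ∫ ω, I ω ∂P = 0 := by
  obtain ⟨p, hp, -, h2⟩ := hf.exists_seq
  have hm := fun n => memLp_snd_of_mem_itoElementary hW (hp n)
  have h := tendsto_integral_of_L1' I hf.memLp.1
    (Eventually.of_forall fun n => (hm n).integrable one_le_two)
    (tendsto_of_tendsto_of_tendsto_of_le_of_le tendsto_const_nhds h2 (fun _ => zero_le)
      fun n => eLpNorm_le_eLpNorm_of_exponent_le one_le_two ((hm n).sub hf.memLp).1)
  simp only [fun n => integral_snd_of_mem_itoElementary hW (hp n)] at h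
  exact tendsto_nhds_unique h tendsto_const_nhds

lemma sub [IsFiniteMeasure P] (hW : IsWienerProcess F W P) (hf : IsItoLimit F W P f I)
    (hg : IsItoLimit F W P g J) : IsItoLimit F W P (f - g) (I - J) := by
  obtain ⟨p, hp, h1, h2⟩ := hf.exists_seq
  obtain ⟨q, hq, h3, h4⟩ := hg.exists_seq
  exact ⟨hf.memLp_integrand.sub hg.memLp_integrand, hf.memLp.sub hg.memLp, fun n => p n - q n,
    fun n => sub_mem (hp n) (hq n),
    tendsto_eLpNorm_sub_sub (fun n => memLp_fst_of_mem_itoElementary (hp n)) hf.memLp_integrand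
      (fun n => memLp_fst_of_mem_itoElementary (hq n)) hg.memLp_integrand h1 h3,
    tendsto_eLpNorm_sub_sub (fun n => memLp_snd_of_mem_itoElementary hW (hp n)) hf.memLp
      (fun n => memLp_snd_of_mem_itoElementary hW (hq n)) hg.memLp h2 h4⟩

lemma of_mem [IsFiniteMeasure P] (hW : IsWienerProcess F W P)
    (h : (f, I) ∈ itoElementary F W) : IsItoLimit F W P f I :=
  ⟨memLp_fst_of_mem_itoElementary h, memLp_snd_of_mem_itoElementary hW h, fun _ => (f, I),
    fun _ => h, by simp, by simp⟩

end IsItoLimit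

lemma const_mem_itoElementary {a c : ℝ≥0} (hac : a ≤ c) (x : ℝ) :
    ((fun q : ℝ × Ω => (Set.Ioc (a : ℝ) c).indicator (fun _ => x) q.1,
      fun ω => x * (W c ω - W a ω)) : (ℝ × Ω → ℝ) × (Ω → ℝ)) ∈ itoElementary F W :=
  Submodule.subset_span ⟨a, c, fun _ => x, |x|, hac, stronglyMeasurable_const,
    fun _ => le_rfl, rfl⟩

lemma ItoSimpleProcess.mem_itoElementary {s t : ℝ≥0} (φ : ItoSimpleProcess F s t) :
    ((fun q : ℝ × Ω => φ.eval q.1 q.2, φ.integral W) : (ℝ × Ω → ℝ) × (Ω → ℝ)) ∈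
      itoElementary F W := by
  obtain ⟨K, hK⟩ := φ.val_bdd
  have h : ((fun q : ℝ × Ω => φ.eval q.1 q.2, φ.integral W) : (ℝ × Ω → ℝ) × (Ω → ℝ)) =
      ∑ i ∈ Finset.range φ.n,
        (fun q : ℝ × Ω => (Set.Ioc (φ.time i : ℝ) (φ.time (i + 1))).indicator
          (fun _ => φ.val i q.2) q.1,
          fun ω => φ.val i ω * (W (φ.time (i + 1)) ω - W (φ.time i) ω)) := by
    ext x <;> simp [ItoSimpleProcess.eval, ItoSimpleProcess.integral, Prod.fst_sum, Prod.snd_sum]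
  rw [h]
  exact sum_mem fun i _ => Submodule.subset_span
    ⟨_, _, _, K, φ.time_mono i.le_succ, φ.val_meas i, hK i, rfl⟩

lemma ItoSimpleProcess.eval_eq_zero {s t : ℝ≥0} (φ : ItoSimpleProcess F s t) {u : ℝ}
    (hu : u ∉ Set.Ioc (s : ℝ) t) (ω : Ω) : φ.eval u ω = 0 := by
  refine Finset.sum_eq_zero fun i hi => Set.indicator_of_notMem (fun h => hu ⟨?_, ?_⟩) _
  · exact lt_of_le_of_lt (by exact_mod_cast φ.time_first.ge.trans (φ.time_mono i.zero_le)) h.1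
  · exact h.2.trans (by exact_mod_cast
      (φ.time_mono (Nat.succ_le_of_lt (Finset.mem_range.1 hi))).trans φ.time_last.le)

lemma eLpNorm_two_sq {α : Type*} {mα : MeasurableSpace α} (μ : Measure α) (f : α → ℝ) :
    eLpNorm f 2 μ ^ 2 = ∫⁻ x, ‖f x‖ₑ ^ 2 ∂μ := by
  have h := eLpNorm_nnreal_pow_eq_lintegral (μ := μ) (f := f) (p := 2) two_ne_zero
  simpa using h

lemma memLp_indicator_comp_fst [IsFiniteMeasure P] {b : ℝ → ℝ} {s t : ℝ}
    (hb : ContinuousOn b (Set.Icc s t)) :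
    MemLp (fun q : ℝ × Ω => (Set.Ioc s t).indicator b q.1) 2 (volume.prod P) := by
  refine MemLp.comp_fst (f := (Set.Ioc s t).indicator b) ?_ P
  rw [memLp_indicator_iff_restrict measurableSet_Ioc]
  obtain ⟨K, hK⟩ := isCompact_Icc.exists_bound_of_continuousOn hb
  refine MemLp.of_bound ((hb.mono Set.Ioc_subset_Icc_self).aestronglyMeasurable
    measurableSet_Ioc) K ?_
  exact (ae_restrict_iff' measurableSet_Ioc).2
    (Eventually.of_forall fun x hx => hK x (Set.Ioc_subset_Icc_self hx))

/-- Extending integrands by zero off `(s, t]` puts integrals over different intervals into one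
space, where they can be subtracted. -/
lemma IsItoIntegral.isItoLimit [IsFiniteMeasure P] {b : ℝ → ℝ} {s t : ℝ≥0} {I : Ω → ℝ}
    (hI : IsItoIntegral F W P (fun u _ => b u) s t I)
    (hb : ContinuousOn b (Set.Icc (s : ℝ) t)) :
    IsItoLimit F W P (fun q => (Set.Ioc (s : ℝ) t).indicator b q.1) I := by
  obtain ⟨hm, φ, h1, h2⟩ := hI
  have hbm := memLp_indicator_comp_fst (P := P) hb
  refine ⟨hbm, hm, fun n => (fun q => (φ n).eval q.1 q.2, (φ n).integral W),
    fun n => (φ n).mem_itoElementary, ?_, h2⟩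
  -- Tonelli: the squared norm on the product is the iterated integral, and both functions vanish
  -- off `(s, t]`.
  have key : ∀ n, eLpNorm ((fun q : ℝ × Ω => (φ n).eval q.1 q.2) -
      fun q => (Set.Ioc (s : ℝ) t).indicator b q.1) 2 (volume.prod P) =
      (∫⁻ u in Set.Ioc (s : ℝ) (t : ℝ), ∫⁻ ω, ‖(φ n).eval u ω - b u‖ₑ ^ 2 ∂P) ^ (2⁻¹ : ℝ) := by
    intro n
    have hmeas := ((memLp_fst_of_mem_itoElementary (P := P)
      ((φ n).mem_itoElementary (W := W))).sub hbm).1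
    rw [← ENNReal.rpow_rpow_inv (two_ne_zero : (2 : ℝ) ≠ 0) (eLpNorm _ _ _),
      ENNReal.rpow_two, eLpNorm_two_sq,
      lintegral_prod _ (hmeas.enorm.pow_const 2), ← lintegral_indicator measurableSet_Ioc]
    congr 1
    refine lintegral_congr fun u => ?_
    by_cases hu : u ∈ Set.Ioc (s : ℝ) t
    · simp [hu]
    · simp [hu, (φ n).eval_eq_zero hu]
  simp only [key]
  have := h1.ennrpow_const (2⁻¹ : ℝ)
  rwa [ENNReal.zero_rpow_of_pos (by norm_num)] at this

end ItoIsometry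

/-! ### Independence through characteristic functions -/

section IndependenceLimits

variable {Ω : Type*} {mΩ : MeasurableSpace Ω} {P : Measure Ω}

lemma iIndepFun_iff_integral_cexp [IsProbabilityMeasure P] {ι : Type*} [Fintype ι]
    {X : ι → Ω → ℝ} (hX : ∀ i, AEMeasurable (X i) P) :
    iIndepFun X P ↔ ∀ t : ι → ℝ, ∫ ω, Complex.exp ((∑ i, t i * X i ω : ℝ) * Complex.I) ∂P =
      ∏ i, ∫ ω, Complex.exp ((t i * X i ω : ℝ) * Complex.I) ∂P := by
  rw [iIndepFun_iff_charFun_pi hX]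
  have h1 : ∀ t : EuclideanSpace ℝ ι, charFun (P.map (fun ω => WithLp.toLp 2 (X · ω))) t =
      ∫ ω, Complex.exp ((∑ i, t i * X i ω : ℝ) * Complex.I) ∂P := fun t => by
    rw [charFun_apply, integral_map (by fun_prop) (by fun_prop)]
    simp [PiLp.inner_apply]
  have h2 : ∀ i (s : ℝ), charFun (P.map (X i)) s =
      ∫ ω, Complex.exp ((s * X i ω : ℝ) * Complex.I) ∂P := fun i s => by
    rw [charFun_apply_real, integral_map (hX i) (by fun_prop)]
    simp
  simp only [h1, h2]
  exact ⟨fun h t => h (WithLp.toLp 2 t), fun h t => h t⟩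

lemma enorm_cexp_mul_I_sub_le (x y : ℝ) :
    ‖Complex.exp (x * Complex.I) - Complex.exp (y * Complex.I)‖ₑ ≤ ‖x - y‖ₑ := by
  have h : Complex.exp (x * Complex.I) - Complex.exp (y * Complex.I) =
      Complex.exp (y * Complex.I) * (Complex.exp (Complex.I * (x - y : ℝ)) - 1) := by
    rw [mul_sub, ← Complex.exp_add, mul_one]
    congr 2
    push_cast
    ring
  rw [h, enorm_mul]
  have h1 : ‖Complex.exp (y * Complex.I)‖ₑ = 1 := by
    rw [← ofReal_norm, Complex.norm_exp_ofReal_mul_I, ENNReal.ofReal_one]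
  rw [h1, one_mul]
  exact Real.enorm_exp_I_mul_ofReal_sub_one_le

/-- The map `x ↦ exp (i x)` is 1-Lipschitz, so `L²`, hence `L¹`, closeness passes to the
exponentials. -/
lemma tendsto_integral_cexp [IsProbabilityMeasure P] {Y : ℕ → Ω → ℝ} {X : Ω → ℝ}
    (hY : ∀ n, AEStronglyMeasurable (Y n) P) (hX : AEStronglyMeasurable X P)
    (h : Tendsto (fun n => eLpNorm (Y n - X) 2 P) atTop (𝓝 0)) :
    Tendsto (fun n => ∫ ω, Complex.exp (Y n ω * Complex.I) ∂P) atTop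
      (𝓝 (∫ ω, Complex.exp (X ω * Complex.I) ∂P)) := by
  have hm : ∀ Z : Ω → ℝ, AEStronglyMeasurable Z P →
      AEStronglyMeasurable (fun ω => Complex.exp (Z ω * Complex.I)) P := fun Z hZ =>
    (by fun_prop : Continuous fun x : ℝ => Complex.exp (x * Complex.I)).comp_aestronglyMeasurable
      hZ
  refine tendsto_integral_of_L1 _ (hm X hX) (Eventually.of_forall fun n => ?_) ?_
  · exact Integrable.of_bound (hm _ (hY n)) 1
      (Eventually.of_forall fun ω => (Complex.norm_exp_ofReal_mul_I _).le)
  · refine tendsto_of_tendsto_of_tendsto_of_le_of_le tendsto_const_nhds h (fun _ => zero_le)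
      fun n => ?_
    refine le_trans ?_ (eLpNorm_le_eLpNorm_of_exponent_le one_le_two ((hY n).sub hX))
    rw [eLpNorm_one_eq_lintegral_enorm]
    exact lintegral_mono fun ω => enorm_cexp_mul_I_sub_le _ _

lemma tendsto_eLpNorm_sum_mul_sub {ι : Type*} [Fintype ι]
    {Y : ℕ → ι → Ω → ℝ} {X : ι → Ω → ℝ} (hY : ∀ n i, AEStronglyMeasurable (Y n i) P)
    (hX : ∀ i, AEStronglyMeasurable (X i) P)
    (h : ∀ i, Tendsto (fun n => eLpNorm (Y n i - X i) 2 P) atTop (𝓝 0)) (t : ι → ℝ) :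
    Tendsto (fun n => eLpNorm ((fun ω => ∑ i, t i * Y n i ω) - fun ω => ∑ i, t i * X i ω) 2 P)
      atTop (𝓝 0) := by
  have hlim : Tendsto (fun n => ∑ i, ‖t i‖ₑ * eLpNorm (Y n i - X i) 2 P) atTop (𝓝 0) := by
    have := tendsto_finsetSum Finset.univ fun i _ =>
      ENNReal.Tendsto.const_mul (h i) (Or.inr (enorm_ne_top (x := t i)))
    simpa using this
  refine tendsto_of_tendsto_of_tendsto_of_le_of_le tendsto_const_nhds hlim (fun _ => zero_le)
    fun n => ?_
  have he : ((fun ω => ∑ i, t i * Y n i ω) - fun ω => ∑ i, t i * X i ω) =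
      ∑ i, t i • (Y n i - X i) := by
    ext ω
    simp [mul_sub, Finset.sum_sub_distrib]
  rw [he]
  refine (eLpNorm_sum_le (fun i _ => ((hY n i).sub (hX i)).const_smul (t i)) one_le_two).trans ?_
  exact Finset.sum_le_sum fun i _ => (eLpNorm_const_smul _ _ _ _).le

/-- Independence passes to limits in `L²`. -/
lemma iIndepFun_of_tendsto_eLpNorm [IsProbabilityMeasure P] {ι : Type*} [Fintype ι]
    {Y : ℕ → ι → Ω → ℝ} {X : ι → Ω → ℝ} (hY : ∀ n i, AEStronglyMeasurable (Y n i) P)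
    (hX : ∀ i, AEStronglyMeasurable (X i) P)
    (h : ∀ i, Tendsto (fun n => eLpNorm (Y n i - X i) 2 P) atTop (𝓝 0))
    (hind : ∀ n, iIndepFun (Y n) P) : iIndepFun X P := by
  rw [iIndepFun_iff_integral_cexp fun i => (hX i).aemeasurable]
  intro t
  have hsum : ∀ Z : ι → Ω → ℝ, (∀ i, AEStronglyMeasurable (Z i) P) →
      AEStronglyMeasurable (fun ω => ∑ i, t i * Z i ω) P := fun Z hZ => by fun_prop
  have h1 := tendsto_integral_cexp (fun n => hsum _ (hY n)) (hsum _ hX)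
    (tendsto_eLpNorm_sum_mul_sub hY hX h t)
  -- Each factor is the one-variable case, obtained from the sum lemma with the index type `Unit`.
  have h2 := tendsto_finsetProd Finset.univ fun i _ =>
    tendsto_integral_cexp (fun n => (hY n i).const_mul (t i)) ((hX i).const_mul (t i)) (by
      have := tendsto_eLpNorm_sum_mul_sub (ι := Unit) (fun n _ => hY n i) (fun _ => hX i)
        (fun _ => h i) (fun _ => t i)
      simpa using this)
  refine tendsto_nhds_unique h1 (h2.congr fun n => ?_)
  exact ((iIndepFun_iff_integral_cexp fun i => (hY n i).aemeasurable).1 (hind n) t).symm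

/-- Two families of independent variables that are independent of each other can be added. -/
lemma ProbabilityTheory.iIndepFun.fun_add_of_indepFun [IsProbabilityMeasure P] {ι : Type*} [Fintype ι]
    {X Y : ι → Ω → ℝ} (hX : ∀ i, AEMeasurable (X i) P) (hY : ∀ i, AEMeasurable (Y i) P)
    (hXi : iIndepFun X P) (hYi : iIndepFun Y P)
    (h : IndepFun (fun ω i => X i ω) (fun ω i => Y i ω) P) :
    iIndepFun (fun i ω => X i ω + Y i ω) P := by
  rw [iIndepFun_iff_integral_cexp (X := fun i ω => X i ω + Y i ω) fun i => (hX i).add (hY i)]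
  intro t
  -- Applied to the full linear form to split the joint characteristic function, then to each
  -- coordinate to recombine the factors.
  have key : ∀ g : (ι → ℝ) → ℝ, Measurable g →
      ∫ ω, Complex.exp (g (X · ω) * Complex.I) * Complex.exp (g (Y · ω) * Complex.I) ∂P =
        (∫ ω, Complex.exp (g (X · ω) * Complex.I) ∂P) *
          ∫ ω, Complex.exp (g (Y · ω) * Complex.I) ∂P := fun g hg =>
    h.integral_fun_comp_mul_comp (f := fun x : ι → ℝ => Complex.exp (g x * Complex.I))
      (g := fun x : ι → ℝ => Complex.exp (g x * Complex.I)) (aemeasurable_pi_lambda _ hX)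
      (aemeasurable_pi_lambda _ hY) (by fun_prop) (by fun_prop)
  have e1 : ∀ ω, Complex.exp ((∑ i, t i * (X i ω + Y i ω) : ℝ) * Complex.I) =
      Complex.exp ((∑ i, t i * X i ω : ℝ) * Complex.I) *
        Complex.exp ((∑ i, t i * Y i ω : ℝ) * Complex.I) := fun ω => by
    simp only [← Complex.exp_add, ← add_mul, ← Complex.ofReal_add, ← Finset.sum_add_distrib,
      mul_add]
  have e2 : ∀ i ω, Complex.exp ((t i * (X i ω + Y i ω) : ℝ) * Complex.I) =
      Complex.exp ((t i * X i ω : ℝ) * Complex.I) *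
        Complex.exp ((t i * Y i ω : ℝ) * Complex.I) := fun i ω => by
    simp only [← Complex.exp_add, ← add_mul, ← Complex.ofReal_add, mul_add]
  simp only [e1, e2]
  rw [key (fun x => ∑ i, t i * x i) (by fun_prop), (iIndepFun_iff_integral_cexp hX).1 hXi,
    (iIndepFun_iff_integral_cexp hY).1 hYi, ← Finset.prod_mul_distrib]
  exact Finset.prod_congr rfl fun i _ => (key (fun x => t i * x i) (by fun_prop)).symm

/-- Linear combinations over disjoint blocks of independent variables are independent. -/
lemma ProbabilityTheory.iIndepFun.sum_mul_block [IsProbabilityMeasure P] {κ ι : Type*} [Fintype κ] [Fintype ι]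
    {D : κ × ι → Ω → ℝ} (hD : ∀ p, AEMeasurable (D p) P) (h : iIndepFun D P)
    (c : κ → ι → ℝ) : iIndepFun (fun k ω => ∑ j, c k j * D (k, j) ω) P := by
  rw [iIndepFun_iff_integral_cexp fun k => by fun_prop]
  intro t
  -- The coefficients are absorbed into the frequencies; the product over pairs is then regrouped
  -- block by block.
  have h1 := (iIndepFun_iff_integral_cexp hD).1 h fun p => t p.1 * c p.1 p.2
  simp only [Fintype.sum_prod_type, Fintype.prod_prod_type] at h1
  simp only [Finset.mul_sum, ← mul_assoc]
  rw [h1]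
  refine Finset.prod_congr rfl fun k _ => ?_
  have hk : iIndepFun (fun j => D (k, j)) P :=
    h.precomp (g := fun j => (k, j)) (Prod.mk_right_injective k)
  exact ((iIndepFun_iff_integral_cexp fun j => hD (k, j)).1 hk fun j => t k * c k j).symm

end IndependenceLimits

/-! ### Lipschitz bound for `b` and increments of the solution -/

lemma exists_lipschitz_of_differentiableOn_derivWithin {b : ℝ → ℝ} {s t : ℝ}
    (hb : DifferentiableOn ℝ b (Set.Icc s t))
    (hb' : DifferentiableOn ℝ (derivWithin b (Set.Icc s t)) (Set.Icc s t)) :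
    ∃ L : ℝ, 0 ≤ L ∧ ∀ x ∈ Set.Icc s t, ∀ y ∈ Set.Icc s t, |b y - b x| ≤ L * |y - x| := by
  obtain ⟨L, hL⟩ := isCompact_Icc.exists_bound_of_continuousOn hb'.continuousOn
  refine ⟨max L 0, le_max_right _ _, fun x hx y hy => ?_⟩
  exact (convex_Icc s t).norm_image_sub_le_of_norm_derivWithin_le hb
    (fun z hz => (hL z hz).trans (le_max_left _ _)) hx hy

section Increments

variable {Ω : Type*} {mΩ : MeasurableSpace Ω} {F : Filtration ℝ≥0 mΩ} {W : ℝ≥0 → Ω → ℝ}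
  {P : Measure Ω}

lemma eLpNorm_prod_le_of_bound [IsProbabilityMeasure P] {f : ℝ × Ω → ℝ} {s t K : ℝ}
    (hK : 0 ≤ K) (h0 : ∀ q, q.1 ∉ Set.Ioc s t → f q = 0)
    (h1 : ∀ q, q.1 ∈ Set.Ioc s t → |f q| ≤ K) :
    eLpNorm f 2 (volume.prod P) ≤ ENNReal.ofReal (K * √(t - s)) := by
  have hm : MeasurableSet (Set.Ioc s t ×ˢ (Set.univ : Set Ω)) :=
    measurableSet_Ioc.prod MeasurableSet.univ
  calc eLpNorm f 2 (volume.prod P)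
      ≤ eLpNorm ((Set.Ioc s t ×ˢ (Set.univ : Set Ω)).indicator fun _ => K) 2
          (volume.prod P) := by
        refine eLpNorm_mono fun q => ?_
        by_cases hq : q.1 ∈ Set.Ioc s t
        · have : q ∈ Set.Ioc s t ×ˢ (Set.univ : Set Ω) := ⟨hq, trivial⟩
          rw [Set.indicator_of_mem this, Real.norm_eq_abs, Real.norm_of_nonneg hK]
          exact h1 q hq
        · rw [h0 q hq, norm_zero]
          exact norm_nonneg _
    _ = _ := by
        rw [eLpNorm_indicator_const hm two_ne_zero ENNReal.ofNat_ne_top, Measure.prod_prod,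
          measure_univ, mul_one, Real.volume_Ioc, Real.enorm_of_nonneg hK,
          ENNReal.ofReal_mul hK, Real.sqrt_eq_rpow]
        rcases le_total 0 (t - s) with h | h
        · rw [ENNReal.ofReal_rpow_of_nonneg h (by simp)]
          simp
        · rw [ENNReal.ofReal_of_nonpos h, ← Real.sqrt_eq_rpow, Real.sqrt_eq_zero_of_nonpos h]
          simp

variable [IsProbabilityMeasure P] {b : ℝ → ℝ} {t₀ T : ℝ≥0} {X : ℝ≥0 → Ω → ℝ}

namespace SolvesAdditiveSDE

/-- Subtracting the integrals over `(t₀, t]` and `(t₀, s]` cancels `X t₀`, so nothing about the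
initial value matters. The free constant `c` serves as the grid mean for local errors and as a
frozen value of `b` for Riemann sums. -/
lemma isItoLimit_sub (hX : SolvesAdditiveSDE F W P b t₀ T X) (hW : IsWienerProcess F W P)
    (hb : ContinuousOn b (Set.Icc (t₀ : ℝ) T)) {s t : ℝ≥0} (hs : t₀ ≤ s) (hst : s ≤ t)
    (ht : t ≤ T) (c : ℝ) :
    IsItoLimit F W P (fun q => (Set.Ioc (s : ℝ) t).indicator (fun u => b u - c) q.1)
      (fun ω => X t ω - X s ω - c * (W t ω - W s ω)) := by
  have hsT : (s : ℝ) ≤ T := hst.trans ht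
  have ht' : (t : ℝ) ≤ T := ht
  have h1 := (hX t (hs.trans hst) ht).isItoLimit (hb.mono (Set.Icc_subset_Icc_right ht'))
  have h2 := (hX s hs (hst.trans ht)).isItoLimit (hb.mono (Set.Icc_subset_Icc_right hsT))
  have h3 := IsItoLimit.of_mem (P := P) hW (const_mem_itoElementary (F := F) (W := W) hst c)
  have h := (h1.sub hW h2).sub hW h3
  have hs' : (t₀ : ℝ) ≤ s := hs
  have hst' : (s : ℝ) ≤ t := hst
  convert! h using 1
  · ext q
    simp only [Pi.sub_apply, Set.indicator, Set.mem_Ioc]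
    split_ifs <;> first | (exfalso; grind) | ring
  · ext ω
    simp only [Pi.sub_apply]
    ring

lemma eLpNorm_sub_le (hX : SolvesAdditiveSDE F W P b t₀ T X) (hW : IsWienerProcess F W P)
    (hb : ContinuousOn b (Set.Icc (t₀ : ℝ) T)) {s t : ℝ≥0} (hs : t₀ ≤ s) (hst : s ≤ t)
    (ht : t ≤ T) {c K : ℝ} (hK : 0 ≤ K)
    (hbc : ∀ u ∈ Set.Icc (s : ℝ) t, |b u - c| ≤ K) :
    eLpNorm (fun ω => X t ω - X s ω - c * (W t ω - W s ω)) 2 P ≤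
      ENNReal.ofReal (K * √(t - s)) := by
  rw [(hX.isItoLimit_sub hW hb hs hst ht c).eLpNorm_eq hW]
  refine eLpNorm_prod_le_of_bound hK (fun q hq => Set.indicator_of_notMem hq _) fun q hq => ?_
  rw [Set.indicator_of_mem hq]
  exact hbc _ (Set.Ioc_subset_Icc_self hq)

end SolvesAdditiveSDE

end Increments

/-! ### The scheme with additive noise and its local errors -/

section Scheme

variable {Ω : Type*} {mΩ : MeasurableSpace Ω} {F : Filtration ℝ≥0 mΩ} {W : ℝ≥0 → Ω → ℝ}
  {P : Measure Ω} {b : ℝ → ℝ} {t₀ T h : ℝ≥0} {X : ℝ≥0 → Ω → ℝ} {S : ℕ → Ω → ℝ}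

lemma gridTime_mono (t₀ h : ℝ≥0) : Monotone (gridTime t₀ h) := fun i j hij => by
  unfold gridTime
  gcongr

lemma le_gridTime (t₀ h : ℝ≥0) (k : ℕ) : t₀ ≤ gridTime t₀ h k := le_self_add

lemma coe_gridTime (t₀ h : ℝ≥0) (k : ℕ) : (gridTime t₀ h k : ℝ) = t₀ + k * h := by
  simp [gridTime]

lemma coe_gridTime_succ (t₀ h : ℝ≥0) (k : ℕ) :
    (gridTime t₀ h (k + 1) : ℝ) = gridTime t₀ h k + h := by
  simp only [coe_gridTime]
  push_cast
  ring

/-- Cutting steps into `n + 1` cells keeps the old grid points and never divides by zero. -/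
lemma gridTime_div (t₀ h : ℝ≥0) (n k : ℕ) :
    gridTime t₀ (h / (n + 1 : ℕ)) ((n + 1) * k) = gridTime t₀ h k := by
  apply NNReal.coe_injective
  rw [coe_gridTime, coe_gridTime]
  push_cast
  field_simp

/-- The mean of the values of `b` at the ends of step `k`. -/
noncomputable def gridMean (b : ℝ → ℝ) (t₀ h : ℝ≥0) (k : ℕ) : ℝ :=
  (b (gridTime t₀ h k) + b (gridTime t₀ h (k + 1))) / 2

/-- The coefficient of the random sign in step `k` of the scheme. -/
noncomputable def signCoeff (b : ℝ → ℝ) (t₀ h : ℝ≥0) (k : ℕ) : ℝ :=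
  √h * (b (gridTime t₀ h (k + 1)) - b (gridTime t₀ h k)) / 2

lemma rkGridStep_additive (k : ℕ) (ω : Ω) (x : ℝ) :
    rkGridStep (fun _ _ => 0) (fun t _ => b t) W S t₀ h k ω x =
      x + gridMean b t₀ h k * (W (gridTime t₀ h (k + 1)) ω - W (gridTime t₀ h k) ω) +
        signCoeff b t₀ h k * S k ω := by
  simp only [rkGridStep, rkStep, gridMean, signCoeff, coe_gridTime_succ]
  ring

lemma rkLocalError_additive (k : ℕ) (ω : Ω) :
    rkLocalError (fun _ _ => 0) (fun t _ => b t) W S t₀ h X k ω =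
      (X (gridTime t₀ h (k + 1)) ω - X (gridTime t₀ h k) ω -
        gridMean b t₀ h k * (W (gridTime t₀ h (k + 1)) ω - W (gridTime t₀ h k) ω)) -
        signCoeff b t₀ h k * S k ω := by
  rw [rkLocalError, rkGridStep_additive]
  ring

/-- A step is a translation in `x`, so it propagates an earlier error unchanged. -/
lemma rkGlobalError_eq_sum (m : ℕ) (ω : Ω) :
    rkGlobalError (fun _ _ => 0) (fun t _ => b t) W S t₀ h X m ω =
      ∑ k ∈ Finset.range m, rkLocalError (fun _ _ => 0) (fun t _ => b t) W S t₀ h X k ω := by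
  induction m with
  | zero => simp [rkGlobalError, rkScheme, gridTime]
  | succ m ih =>
    rw [Finset.sum_range_succ, ← ih]
    simp only [rkGlobalError, rkLocalError, rkScheme, rkGridStep_additive]
    ring

lemma memLp_rkLocalError [IsProbabilityMeasure P] (hW : IsWienerProcess F W P)
    (hX : SolvesAdditiveSDE F W P b t₀ T X) (hb : ContinuousOn b (Set.Icc (t₀ : ℝ) T)) {k : ℕ}
    (hk : gridTime t₀ h (k + 1) ≤ T) (hS : MemLp (S k) 2 P) :
    MemLp (rkLocalError (fun _ _ => 0) (fun t _ => b t) W S t₀ h X k) 2 P := by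
  have h1 := hX.isItoLimit_sub hW hb (le_gridTime t₀ h k) (gridTime_mono t₀ h k.le_succ) hk
    (gridMean b t₀ h k)
  exact (h1.memLp.sub (hS.const_mul (signCoeff b t₀ h k))).ae_eq
    (Eventually.of_forall fun ω => (rkLocalError_additive k ω).symm)

lemma integral_rkLocalError [IsProbabilityMeasure P] (hW : IsWienerProcess F W P)
    (hX : SolvesAdditiveSDE F W P b t₀ T X) (hb : ContinuousOn b (Set.Icc (t₀ : ℝ) T)) {k : ℕ}
    (hk : gridTime t₀ h (k + 1) ≤ T) (hS : MemLp (S k) 2 P) (hS0 : ∫ ω, S k ω ∂P = 0) :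
    ∫ ω, rkLocalError (fun _ _ => 0) (fun t _ => b t) W S t₀ h X k ω ∂P = 0 := by
  have h1 := hX.isItoLimit_sub hW hb (le_gridTime t₀ h k) (gridTime_mono t₀ h k.le_succ) hk
    (gridMean b t₀ h k)
  simp only [rkLocalError_additive]
  rw [integral_sub (h1.memLp.integrable one_le_two)
    ((hS.const_mul (signCoeff b t₀ h k)).integrable one_le_two), h1.integral_eq_zero hW,
    integral_const_mul, hS0, mul_zero, sub_zero]

lemma gridTime_mem_Icc {k m : ℕ} (hk : k ≤ m) (hm : gridTime t₀ h m ≤ T) :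
    (gridTime t₀ h k : ℝ) ∈ Set.Icc (t₀ : ℝ) T :=
  ⟨le_gridTime t₀ h k, (gridTime_mono t₀ h hk).trans hm⟩

lemma eLpNorm_rkLocalError_le [IsProbabilityMeasure P] (hW : IsWienerProcess F W P)
    (hX : SolvesAdditiveSDE F W P b t₀ T X) (hb : ContinuousOn b (Set.Icc (t₀ : ℝ) T))
    {L V : ℝ} (hL : 0 ≤ L)
    (hbL : ∀ x ∈ Set.Icc (t₀ : ℝ) T, ∀ y ∈ Set.Icc (t₀ : ℝ) T, |b y - b x| ≤ L * |y - x|)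
    {k : ℕ} (hk : gridTime t₀ h (k + 1) ≤ T) (hS : MemLp (S k) 2 P)
    (hS0 : ∫ ω, S k ω ∂P = 0) (hSV : variance (S k) P ≤ V) :
    eLpNorm (rkLocalError (fun _ _ => 0) (fun t _ => b t) W S t₀ h X k) 2 P ≤
      ENNReal.ofReal (L * (1 + √V / 2) * h * √h) := by
  have m0 := gridTime_mem_Icc k.le_succ hk
  have m1 := gridTime_mem_Icc le_rfl hk
  have hd := coe_gridTime_succ t₀ h k
  have hh : (0 : ℝ) ≤ h := h.2
  have h1 := hX.isItoLimit_sub hW hb (le_gridTime t₀ h k) (gridTime_mono t₀ h k.le_succ) hk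
    (gridMean b t₀ h k)
  have h2 := hX.eLpNorm_sub_le hW hb (le_gridTime t₀ h k) (gridTime_mono t₀ h k.le_succ) hk
    -- Each endpoint is within `h` of `u`, so averaging the two Lipschitz bounds gives `L * h`.
    (c := gridMean b t₀ h k) (K := L * h) (by positivity) (fun u hu => by
      have mu : u ∈ Set.Icc (t₀ : ℝ) T := ⟨m0.1.trans hu.1, hu.2.trans m1.2⟩
      have e0 : |b u - b (gridTime t₀ h k)| ≤ L * h :=
        (hbL _ m0 u mu).trans (mul_le_mul_of_nonneg_left
          (abs_le.2 ⟨by linarith [hu.1], by linarith [hu.2]⟩) hL)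
      have e1 : |b u - b (gridTime t₀ h (k + 1))| ≤ L * h :=
        (hbL _ m1 u mu).trans (mul_le_mul_of_nonneg_left
          (abs_le.2 ⟨by linarith [hu.1], by linarith [hu.2]⟩) hL)
      rw [abs_le] at e0 e1 ⊢
      unfold gridMean
      constructor <;> linarith [e0.1, e0.2, e1.1, e1.2])
  have hSn : eLpNorm (S k) 2 P ≤ ENNReal.ofReal √V := by
    rw [eLpNorm_two_eq_ofReal_sqrt hS, ← variance_of_integral_eq_zero hS.aemeasurable hS0]
    exact ENNReal.ofReal_le_ofReal (Real.sqrt_le_sqrt hSV)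
  have hc : |signCoeff b t₀ h k| ≤ √h * (L * h) / 2 := by
    have e := hbL _ m0 _ m1
    rw [hd, add_sub_cancel_left, abs_of_nonneg hh, ← hd] at e
    rw [signCoeff, abs_div, abs_mul, abs_of_nonneg (Real.sqrt_nonneg _), abs_two]
    gcongr
  have hS2 : eLpNorm (fun ω => signCoeff b t₀ h k * S k ω) 2 P ≤
      ENNReal.ofReal (√h * (L * h) / 2 * √V) := by
    refine (eLpNorm_const_smul (signCoeff b t₀ h k) (S k) 2 P).trans_le ?_
    rw [ENNReal.ofReal_mul (by positivity)]
    refine mul_le_mul' ?_ hSn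
    rw [← ofReal_norm, Real.norm_eq_abs]
    exact ENNReal.ofReal_le_ofReal hc
  have he : rkLocalError (fun _ _ => 0) (fun t _ => b t) W S t₀ h X k =
      (fun ω => X (gridTime t₀ h (k + 1)) ω - X (gridTime t₀ h k) ω -
        gridMean b t₀ h k * (W (gridTime t₀ h (k + 1)) ω - W (gridTime t₀ h k) ω)) -
      fun ω => signCoeff b t₀ h k * S k ω := funext fun ω => rkLocalError_additive k ω
  rw [he]
  refine (MeasureTheory.eLpNorm_sub_le h1.memLp.1 (hS.const_mul _).1 one_le_two).trans
    ((add_le_add h2 hS2).trans ?_)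
  rw [← ENNReal.ofReal_add (by positivity) (by positivity), hd, add_sub_cancel_left]
  exact ENNReal.ofReal_le_ofReal (le_of_eq (by ring))

lemma integral_sq_le_of_eLpNorm_le {Z : Ω → ℝ} (hZ : MemLp Z 2 P) {K : ℝ} (hK : 0 ≤ K)
    (h : eLpNorm Z 2 P ≤ ENNReal.ofReal K) : ∫ ω, Z ω ^ 2 ∂P ≤ K ^ 2 := by
  rw [eLpNorm_two_eq_ofReal_sqrt hZ, ENNReal.ofReal_le_ofReal_iff hK] at h
  exact (Real.sqrt_le_left hK).1 h

end Scheme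

/-! ### Riemann sums and independence of the local errors -/

section Independence

variable {Ω : Type*} {mΩ : MeasurableSpace Ω} {F : Filtration ℝ≥0 mΩ} {W : ℝ≥0 → Ω → ℝ}
  {P : Measure Ω} {b : ℝ → ℝ} {t₀ T h : ℝ≥0} {X : ℝ≥0 → Ω → ℝ} {S : ℕ → Ω → ℝ}

/-- The increment of `W` over the cell `j` of step `k`, when each step of the grid is cut into
`n + 1` equal cells. -/
noncomputable def cellIncrement (W : ℝ≥0 → Ω → ℝ) (t₀ h : ℝ≥0) (n k j : ℕ) (ω : Ω) : ℝ :=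
  W (gridTime t₀ (h / (n + 1 : ℕ)) ((n + 1) * k + j + 1)) ω -
    W (gridTime t₀ (h / (n + 1 : ℕ)) ((n + 1) * k + j)) ω

/-- The Riemann sum for the integral of `b` minus its grid mean over step `k`, on `n + 1` cells. -/
noncomputable def cellSum (b : ℝ → ℝ) (W : ℝ≥0 → Ω → ℝ) (t₀ h : ℝ≥0) (n k : ℕ) (ω : Ω) : ℝ :=
  ∑ j : Fin (n + 1), (b (gridTime t₀ (h / (n + 1 : ℕ)) ((n + 1) * k + j)) - gridMean b t₀ h k) *
    cellIncrement W t₀ h n k j ω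

lemma sum_sub_gridTime_div (Z : ℝ≥0 → Ω → ℝ) (n k : ℕ) (ω : Ω) :
    ∑ j ∈ Finset.range (n + 1), (Z (gridTime t₀ (h / (n + 1 : ℕ)) ((n + 1) * k + j + 1)) ω -
      Z (gridTime t₀ (h / (n + 1 : ℕ)) ((n + 1) * k + j)) ω) =
      Z (gridTime t₀ h (k + 1)) ω - Z (gridTime t₀ h k) ω := by
  simp only [add_assoc _ _ 1]
  rw [Finset.sum_range_sub (fun j => Z (gridTime t₀ (h / (n + 1 : ℕ)) ((n + 1) * k + j)) ω)
    (n + 1), ← Nat.mul_succ, gridTime_div, add_zero, gridTime_div]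

/-- After telescoping the grid mean cancels; what remains is the error of freezing `b` at the left
end of each cell. -/
lemma sub_cellSum (n k : ℕ) (ω : Ω) :
    (X (gridTime t₀ h (k + 1)) ω - X (gridTime t₀ h k) ω -
      gridMean b t₀ h k * (W (gridTime t₀ h (k + 1)) ω - W (gridTime t₀ h k) ω)) -
        cellSum b W t₀ h n k ω =
    ∑ j ∈ Finset.range (n + 1), (X (gridTime t₀ (h / (n + 1 : ℕ)) ((n + 1) * k + j + 1)) ω -
      X (gridTime t₀ (h / (n + 1 : ℕ)) ((n + 1) * k + j)) ω -
      b (gridTime t₀ (h / (n + 1 : ℕ)) ((n + 1) * k + j)) *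
        (W (gridTime t₀ (h / (n + 1 : ℕ)) ((n + 1) * k + j + 1)) ω -
          W (gridTime t₀ (h / (n + 1 : ℕ)) ((n + 1) * k + j)) ω)) := by
  rw [Finset.sum_sub_distrib, sum_sub_gridTime_div, ← sum_sub_gridTime_div W n k ω, cellSum,
    Fin.sum_univ_eq_sum_range (fun j =>
      (b (gridTime t₀ (h / (n + 1 : ℕ)) ((n + 1) * k + j)) - gridMean b t₀ h k) *
        cellIncrement W t₀ h n k j ω)]
  simp only [sub_mul, Finset.sum_sub_distrib, Finset.mul_sum, cellIncrement, mul_sub]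
  ring

/-- With `δ = h / (n + 1)`, each cell contributes at most `L δ √δ`. The plain triangle inequality
over `n + 1` cells gives `L h √δ`, which already tends to zero. -/
lemma eLpNorm_sub_cellSum_le [IsProbabilityMeasure P] (hW : IsWienerProcess F W P)
    (hX : SolvesAdditiveSDE F W P b t₀ T X) (hb : ContinuousOn b (Set.Icc (t₀ : ℝ) T))
    {L : ℝ} (hL : 0 ≤ L)
    (hbL : ∀ x ∈ Set.Icc (t₀ : ℝ) T, ∀ y ∈ Set.Icc (t₀ : ℝ) T, |b y - b x| ≤ L * |y - x|)
    {k : ℕ} (hk : gridTime t₀ h (k + 1) ≤ T) (n : ℕ) :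
    eLpNorm (fun ω => (X (gridTime t₀ h (k + 1)) ω - X (gridTime t₀ h k) ω -
      gridMean b t₀ h k * (W (gridTime t₀ h (k + 1)) ω - W (gridTime t₀ h k) ω)) -
        cellSum b W t₀ h n k ω) 2 P ≤ ENNReal.ofReal (L * h * √(h / (n + 1))) := by
  simp only [sub_cellSum]
  have hmono := gridTime_mono t₀ (h / (n + 1 : ℕ))
  have hle : ∀ j ∈ Finset.range (n + 1),
      gridTime t₀ (h / (n + 1 : ℕ)) ((n + 1) * k + j + 1) ≤ T := fun j hj => by
    refine le_trans ?_ hk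
    rw [← gridTime_div t₀ h n (k + 1)]
    refine hmono ?_
    have := Finset.mem_range.1 hj
    rw [Nat.mul_succ]
    lia
  have hcell : ∀ j ∈ Finset.range (n + 1),
      eLpNorm (fun ω => X (gridTime t₀ (h / (n + 1 : ℕ)) ((n + 1) * k + j + 1)) ω -
        X (gridTime t₀ (h / (n + 1 : ℕ)) ((n + 1) * k + j)) ω -
        b (gridTime t₀ (h / (n + 1 : ℕ)) ((n + 1) * k + j)) *
          (W (gridTime t₀ (h / (n + 1 : ℕ)) ((n + 1) * k + j + 1)) ω -
            W (gridTime t₀ (h / (n + 1 : ℕ)) ((n + 1) * k + j)) ω)) 2 P ≤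
        ENNReal.ofReal (L * (h / (n + 1)) * √(h / (n + 1))) := fun j hj => by
    have hd := coe_gridTime_succ t₀ (h / (n + 1 : ℕ)) ((n + 1) * k + j)
    have m0 := gridTime_mem_Icc (Nat.le_succ _) (hle j hj)
    have hpos : (0 : ℝ) ≤ h / (n + 1) := by positivity
    push_cast at hd
    have := hX.eLpNorm_sub_le hW hb (le_gridTime t₀ _ _) (hmono (Nat.le_succ _)) (hle j hj)
      (c := b (gridTime t₀ (h / (n + 1 : ℕ)) ((n + 1) * k + j))) (K := L * (h / (n + 1)))
      (by positivity) (fun u hu => by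
        refine (hbL _ m0 u ⟨m0.1.trans hu.1, hu.2.trans (hle j hj)⟩).trans
          (mul_le_mul_of_nonneg_left ?_ hL)
        have h2 := hu.2
        push_cast at h2
        exact abs_le.2 ⟨by linarith [hu.1], by push_cast at *; linarith [hu.1]⟩)
    refine this.trans (le_of_eq ?_)
    congr 3
    push_cast at *
    linarith
  have hmeas : ∀ j ∈ Finset.range (n + 1), AEStronglyMeasurable
      (fun ω => X (gridTime t₀ (h / (n + 1 : ℕ)) ((n + 1) * k + j + 1)) ω -
        X (gridTime t₀ (h / (n + 1 : ℕ)) ((n + 1) * k + j)) ω -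
        b (gridTime t₀ (h / (n + 1 : ℕ)) ((n + 1) * k + j)) *
          (W (gridTime t₀ (h / (n + 1 : ℕ)) ((n + 1) * k + j + 1)) ω -
            W (gridTime t₀ (h / (n + 1 : ℕ)) ((n + 1) * k + j)) ω)) P := fun j hj =>
    (hX.isItoLimit_sub hW hb (le_gridTime t₀ _ _) (hmono (Nat.le_succ _)) (hle j hj) _).memLp.1
  have hsum := eLpNorm_sum_le hmeas (p := 2) one_le_two
  simp only [Finset.sum_fn] at hsum
  refine hsum.trans ((Finset.sum_le_sum hcell).trans ?_)
  rw [Finset.sum_const, Finset.card_range, nsmul_eq_mul, ← ENNReal.ofReal_natCast,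
    ← ENNReal.ofReal_mul (by positivity)]
  refine ENNReal.ofReal_le_ofReal (le_of_eq ?_)
  push_cast
  field_simp

lemma measurable_cellSum (hW : IsWienerProcess F W P) (n k : ℕ) :
    Measurable (cellSum b W t₀ h n k) :=
  Finset.measurable_sum _ fun _ _ =>
    ((hW.measurable _).sub (hW.measurable _)).const_mul _

lemma iIndepFun_cellSum [IsProbabilityMeasure P] (hW : IsWienerProcess F W P) (n m : ℕ) :
    iIndepFun (fun k : Fin m => cellSum b W t₀ h n k) P := by
  have h1 := hW.law.hasIndepIncrements.nat (gridTime_mono t₀ (h / (n + 1 : ℕ)))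
  -- The numbering of cells is injective because `j < n + 1`, so different steps use disjoint
  -- increments.
  have h2 := h1.precomp (g := fun p : Fin m × Fin (n + 1) => ((n + 1) * p.1 + p.2 : ℕ))
    (fun p q hpq => finProdFinEquiv.injective (Fin.ext (by
      simp only [finProdFinEquiv_apply_val]
      simp only at hpq
      lia)))
  exact h2.sum_mul_block (D := fun p : Fin m × Fin (n + 1) => cellIncrement W t₀ h n p.1 p.2)
    (fun p => ((hW.measurable _).sub (hW.measurable _)).aemeasurable)
    (fun k j => b (gridTime t₀ (h / (n + 1 : ℕ)) ((n + 1) * k + j)) - gridMean b t₀ h k)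

lemma iIndepFun_cellSum_add [IsProbabilityMeasure P] (hW : IsWienerProcess F W P)
    (hSm : ∀ k, AEMeasurable (S k) P) (hS : iIndepFun S P)
    (hSW : IndepFun (fun ω k => S k ω) (fun ω t => W t ω) P) (d : ℕ → ℝ) (n m : ℕ) :
    iIndepFun (fun (k : Fin m) ω => cellSum b W t₀ h n k ω + d k * S k ω) P := by
  refine iIndepFun.fun_add_of_indepFun (X := fun k : Fin m => cellSum b W t₀ h n k)
    (Y := fun (k : Fin m) ω => d k * S k ω)
    (fun k => (measurable_cellSum hW n k).aemeasurable) (fun k => (hSm k).const_mul _)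
    (iIndepFun_cellSum hW n m) ?_ ?_
  · exact (hS.precomp (g := fun k : Fin m => (k : ℕ)) Fin.val_injective).comp
      (fun k x => d k * x) fun k => by fun_prop
  · refine hSW.symm.comp
      -- The one-point sample space `Unit` turns `cellSum` into a measurable functional of the path
      -- `w`.
      (φ := fun w (k : Fin m) => cellSum b (fun t (_ : Unit) => w t) t₀ h n k ())
      (ψ := fun s (k : Fin m) => d k * s k) ?_ (by fun_prop)
    simp only [cellSum, cellIncrement]
    fun_prop

lemma iIndepFun_rkLocalError [IsProbabilityMeasure P] (hW : IsWienerProcess F W P)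
    (hX : SolvesAdditiveSDE F W P b t₀ T X) (hb : ContinuousOn b (Set.Icc (t₀ : ℝ) T))
    {L : ℝ} (hL : 0 ≤ L)
    (hbL : ∀ x ∈ Set.Icc (t₀ : ℝ) T, ∀ y ∈ Set.Icc (t₀ : ℝ) T, |b y - b x| ≤ L * |y - x|)
    (hSm : ∀ k, MemLp (S k) 2 P) (hS : iIndepFun S P)
    (hSW : IndepFun (fun ω k => S k ω) (fun ω t => W t ω) P) {m : ℕ}
    (hm : gridTime t₀ h m ≤ T) :
    iIndepFun (fun k : Fin m => rkLocalError (fun _ _ => 0) (fun t _ => b t) W S t₀ h X k) P := by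
  have hk : ∀ k : Fin m, gridTime t₀ h (k + 1) ≤ T := fun k =>
    (gridTime_mono t₀ h k.2).trans hm
  have hSa := fun k => (hSm k).aemeasurable
  refine iIndepFun_of_tendsto_eLpNorm
    (Y := fun n (k : Fin m) ω => cellSum b W t₀ h n k ω + -signCoeff b t₀ h k * S k ω)
    (fun n k => ((measurable_cellSum hW n k).aemeasurable.add
      ((hSa k).const_mul _)).aestronglyMeasurable)
    (fun k => (memLp_rkLocalError hW hX hb (hk k) (hSm k)).1) (fun k => ?_)
    (fun n => iIndepFun_cellSum_add hW hSa hS hSW (fun k => -signCoeff b t₀ h k) n m)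
  have hlim : Tendsto (fun n : ℕ => ENNReal.ofReal (L * h * √(h / (n + 1)))) atTop (𝓝 0) := by
    have h1 : Tendsto (fun n : ℕ => (h : ℝ) / (n + 1)) atTop (𝓝 0) := by
      have := (tendsto_one_div_add_atTop_nhds_zero_nat (𝕜 := ℝ)).const_mul (h : ℝ)
      simpa [div_eq_mul_inv] using this
    have h2 := ENNReal.tendsto_ofReal
      (((Real.continuous_sqrt.tendsto 0).comp h1).const_mul (L * (h : ℝ)))
    simpa using h2
  refine tendsto_of_tendsto_of_tendsto_of_le_of_le tendsto_const_nhds hlim (fun _ => zero_le)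
    fun n => ?_
  refine le_trans (le_of_eq ?_) (eLpNorm_sub_cellSum_le hW hX hb hL hbL (hk k) n)
  rw [eLpNorm_sub_comm]
  congr 1
  ext ω
  simp only [Pi.sub_apply, rkLocalError_additive]
  ring

end Independence

/-! ### Error bounds for the scheme -/

theorem mainTheorem4 (b : ℝ → ℝ) (t₀ T : ℝ≥0)
    (hb : DifferentiableOn ℝ b (Set.Icc (t₀ : ℝ) T))
    (hb' : DifferentiableOn ℝ (derivWithin b (Set.Icc (t₀ : ℝ) T)) (Set.Icc (t₀ : ℝ) T))
    (V : ℝ) :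
    ∃ C : ℝ, 0 ≤ C ∧
      ∀ (Ω : Type*) [mΩ : MeasurableSpace Ω] (P : Measure Ω) [IsProbabilityMeasure P]
        (F : Filtration ℝ≥0 mΩ) (W : ℝ≥0 → Ω → ℝ) (X : ℝ≥0 → Ω → ℝ) (S : ℕ → Ω → ℝ),
        IsWienerProcess F W P →
        SolvesAdditiveSDE F W P b t₀ T X →
        (∀ k, MemLp (S k) 2 P ∧ ∫ ω, S k ω ∂P = 0 ∧ variance (S k) P ≤ V) →
        iIndepFun S P →
        IndepFun (fun ω k => S k ω) (fun ω t => W t ω) P →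
        ∀ (h : ℝ≥0) (m : ℕ), 0 < h → gridTime t₀ h m ≤ T →
          let ε := rkLocalError (fun _ _ => 0) (fun t _ => b t) W S t₀ h X
          let e := rkGlobalError (fun _ _ => 0) (fun t _ => b t) W S t₀ h X m
          (∀ k < m, MemLp (ε k) 2 P ∧ ∫ ω, ε k ω ∂P = 0 ∧ variance (ε k) P ≤ C * (h : ℝ) ^ 3) ∧
          iIndepFun (fun k : Fin m => ε k) P ∧
          (∀ ω, e ω = ∑ k ∈ Finset.range m, ε k ω) ∧
          MemLp e 2 P ∧ ∫ ω, e ω ∂P = 0 ∧ variance e P ≤ C * (h : ℝ) ^ 2 ∧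
          eLpNorm e 2 P ≤ ENNReal.ofReal (C * h) := by
  obtain ⟨L, hL, hbL⟩ := exists_lipschitz_of_differentiableOn_derivWithin hb hb'
  -- The local `L²` error is at most `A h √h`. For `V < 0` the root is zero and no sequence `S`
  -- qualifies.
  set A : ℝ := L * (1 + √V / 2) with hA
  have hA0 : 0 ≤ A := by positivity
  -- The summands serve the local variance, the global variance and the root mean square error
  -- respectively.
  refine ⟨A ^ 2 + A ^ 2 * T + A * √T, by positivity, ?_⟩
  intro Ω mΩ P hP F W X S hW hX hS hSi hSW h m hh hm ε e
  have hbc := hb.continuousOn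
  have hk : ∀ k < m, gridTime t₀ h (k + 1) ≤ T := fun k hk => (gridTime_mono t₀ h hk).trans hm
  have hεm : ∀ k < m, MemLp (ε k) 2 P := fun k hkm =>
    memLp_rkLocalError hW hX hbc (hk k hkm) (hS k).1
  have hε0 : ∀ k < m, ∫ ω, ε k ω ∂P = 0 := fun k hkm =>
    integral_rkLocalError hW hX hbc (hk k hkm) (hS k).1 (hS k).2.1
  have hεV : ∀ k < m, variance (ε k) P ≤ A ^ 2 * (h : ℝ) ^ 3 := fun k hkm => by
    rw [variance_of_integral_eq_zero (hεm k hkm).aemeasurable (hε0 k hkm)]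
    refine (integral_sq_le_of_eLpNorm_le (hεm k hkm) (by positivity)
      (eLpNorm_rkLocalError_le hW hX hbc hL hbL (hk k hkm) (hS k).1 (hS k).2.1
        (hS k).2.2)).trans (le_of_eq ?_)
    rw [mul_pow, mul_pow, Real.sq_sqrt h.coe_nonneg]
    ring
  have hεi : iIndepFun (fun k : Fin m => ε k) P :=
    iIndepFun_rkLocalError hW hX hbc hL hbL (fun k => (hS k).1) hSi hSW hm
  have he : ∀ ω, e ω = ∑ k ∈ Finset.range m, ε k ω := rkGlobalError_eq_sum m
  have he' : e = ∑ k : Fin m, ε k := by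
    ext ω
    rw [he, Finset.sum_apply, Fin.sum_univ_eq_sum_range (fun k => ε k ω)]
  have hem : MemLp e 2 P := by
    rw [he']
    exact memLp_finsetSum' _ fun k _ => hεm k k.2
  have he0 : ∫ ω, e ω ∂P = 0 := by
    simp only [he]
    rw [integral_finsetSum _ fun k hk' =>
      (hεm k (Finset.mem_range.1 hk')).integrable one_le_two]
    exact Finset.sum_eq_zero fun k hk' => hε0 k (Finset.mem_range.1 hk')
  have hmT : (m : ℝ) * h ≤ T := by
    have : (gridTime t₀ h m : ℝ) ≤ T := hm
    rw [coe_gridTime] at this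
    linarith [t₀.2]
  -- Additivity of variances is essential: summing `L²` norms would give only order `√h` for the
  -- global error.
  have heV : variance e P ≤ A ^ 2 * T * (h : ℝ) ^ 2 := by
    have hsum := IndepFun.variance_sum (X := fun k : Fin m => ε k) (s := Finset.univ)
      (fun k _ => hεm k k.2) fun i _ j _ hij => hεi.indepFun hij
    rw [he', hsum]
    calc ∑ k : Fin m, variance (ε k) P ≤ ∑ _k : Fin m, A ^ 2 * (h : ℝ) ^ 3 :=
          Finset.sum_le_sum fun k _ => hεV k k.2
      _ = A ^ 2 * (m * h) * (h : ℝ) ^ 2 := by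
          rw [Finset.sum_const, Finset.card_univ, Fintype.card_fin, nsmul_eq_mul]
          ring
      _ ≤ _ := by gcongr
  have hT : (0 : ℝ) ≤ T := T.2
  have c1 : 0 ≤ A ^ 2 * (T : ℝ) := by positivity
  have c2 : 0 ≤ A * √(T : ℝ) := by positivity
  refine ⟨fun k hkm => ⟨hεm k hkm, hε0 k hkm, (hεV k hkm).trans ?_⟩, hεi, he, hem, he0,
    heV.trans ?_, ?_⟩
  · exact mul_le_mul_of_nonneg_right (by linarith) (by positivity)
  · exact mul_le_mul_of_nonneg_right (by nlinarith [sq_nonneg A]) (by positivity)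
  · rw [eLpNorm_two_eq_ofReal_sqrt hem]
    refine ENNReal.ofReal_le_ofReal ?_
    rw [variance_of_integral_eq_zero hem.aemeasurable he0] at heV
    calc √(∫ ω, e ω ^ 2 ∂P) ≤ √((A * √T * h) ^ 2) := by
          refine Real.sqrt_le_sqrt (heV.trans (le_of_eq ?_))
          rw [mul_pow (A * √T), mul_pow A √T, Real.sq_sqrt hT]
      _ = A * √T * h := Real.sqrt_sq (by positivity)
      _ ≤ _ := mul_le_mul_of_nonneg_right (by nlinarith [sq_nonneg A]) h.2
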